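/- Theorem (Evolution of displacement operators through a linear optics network). Let $m\ge 0$, let $\mathcal F=\ell^2(\mathbb N^m)$ be the Fock space of $m$ bosonic modes, with photon-number basis $|n\rangle=|n_1,\dots,n_m\rangle$ and vacuum $|0\rangle$, let $\hat a_j^\dagger,\hat a_j$ be the creation and annihilation operators (on their maximal domains), $\hat a_j^\dagger|n\rangle=\sqrt{n_j+1}\,|n+e_j\rangle$ and $\hat a_j|n\rangle=\sqrt{n_j}\,|n-e_j\rangle$, and let $\mathcal F_0\subset\mathcal F$ be the dense subspace of finite linear combinations of basis vectors. For $\alpha\in\mathbb C$ let $\hat D_j(\alpha)=\exp(\alpha\hat a_j^\dagger-\alpha^*\hat a_j)$ be the displacement operator on mode $j$, i.e. the bounded operator with $\hat D_j(\alpha)\psi=\sum_{n\ge 0}\frac1{n!}(\alpha\hat a_j^\dagger-\alpha^*\hat a_j)^n\psi$ (norm convergent) for $\psi\in\mathcal F_0$. Let $U$ be a unitary $m\times m$ matrix. Then: 1. For all $j$ and $\alpha$ there is exactly one such operator $\hat D_j(\alpha)$, and it is unitary. 2. There is exactly one unitary $\hat U$ on $\mathcal F$ with $\hat U|0\rangle=|0\rangle$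 and $\hat U\hat a_j^\dagger\hat U^\dagger=\sum_{k=1}^m U_{k,j}\hat a_k^\dagger$ on $\mathcal F_0$ for all $j$; likewise there is exactly one with $\hat U|0\rangle=|0\rangle$ and $\hat U\hat a_j^\dagger\hat U^\dagger=\sum_{k=1}^m U_{j,k}\hat a_k^\dagger$ on $\mathcal F_0$ for all $j$. 3. If $\hat U$ is a unitary on $\mathcal F$ with $\hat U\hat a_j^\dagger\hat U^\dagger=\sum_{k=1}^m U_{k,j}\hat a_k^\dagger$ on $\mathcal F_0$ for all $j$, then for all $\lambda\in\mathbb C^m$ $$\hat U\Big(\prod_{j=1}^m\hat D_j(\lambda_j)\Big)\hat U^\dagger=\prod_{j=1}^m\hat D_j(\mu_j),\qquad \mu_j=\sum_{k=1}^m U_{j,k}\lambda_k .$$ 4. If $\hat U$ is a unitary on $\mathcal F$ with, in the transposed index convention, $\hat U\hat a_j^\dagger\hat U^\dagger=\sum_{k=1}^m U_{j,k}\hat a_k^\dagger$ on $\mathcal F_0$ for all $j$, then for all $\lambda\in\mathbb C^m$ the same identity holds with $\mu_j=\sum_{k=1}^m U_{k,j}\lambda_k$. -/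

import Mathlib

open scoped ComplexConjugate

/-- The Fock space of `m` bosonic modes, `ℓ²(ℕ^m)`. The coordinate `ψ n` of a vector `ψ` is its
amplitude `⟨n|ψ⟩` at the photon-number state `|n₁, …, n_m⟩`. -/
abbrev FockSpace (m : ℕ) : Type := lp (fun _ : Fin m → ℕ => ℂ) 2

namespace FockSpace

variable {m : ℕ}

/-- The vacuum state `|0⟩^{⊗ m}`. -/
noncomputable def vacuum (m : ℕ) : FockSpace m := lp.single 2 (0 : Fin m → ℕ) (1 : ℂ)

/-- The finite-particle vectors: finite linear combinations of photon-number states. -/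
def finiteVectors (m : ℕ) : Submodule ℂ (FockSpace m) where
  carrier := {ψ | (Function.support fun n => ψ n).Finite}
  zero_mem' := by
    have h : (Function.support fun n => (0 : FockSpace m) n) = ∅ := by
      ext n; simp
    change (Function.support fun n => (0 : FockSpace m) n).Finite
    rw [h]
    exact Set.finite_empty
  add_mem' := by
    intro a b ha hb
    refine (ha.union hb).subset ?_
    intro n hn
    by_contra hc
    simp only [Set.mem_union, Function.mem_support, not_or, not_not] at hc
    exact hn (by simp [hc.1, hc.2])
  smul_mem' := by
    intro c a ha
    refine ha.subset ?_
    intro n hn hc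
    have hc' : a n = 0 := hc
    exact hn (by simp [hc'])

/-- The unbounded operator on Fock space acting on coordinates as `S`, with its maximal domain: all
`ψ` for which `S ψ` is again square summable. -/
def maximalOperator (S : ((Fin m → ℕ) → ℂ) →ₗ[ℂ] ((Fin m → ℕ) → ℂ)) :
    FockSpace m →ₗ.[ℂ] FockSpace m where
  domain :=
    { carrier := {ψ | Memℓp (E := fun _ : Fin m → ℕ => ℂ) (S fun n => ψ n) 2}
      zero_mem' := by
        change Memℓp (E := fun _ : Fin m → ℕ => ℂ) (S 0) 2
        rw [map_zero]
        exact zero_memℓp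
      add_mem' := by
        intro a b ha hb
        change Memℓp (E := fun _ : Fin m → ℕ => ℂ) (S ((fun n => a n) + fun n => b n)) 2
        rw [map_add]
        exact Memℓp.add ha hb
      smul_mem' := by
        intro c a ha
        change Memℓp (E := fun _ : Fin m → ℕ => ℂ) (S (c • fun n => a n)) 2
        rw [map_smul]
        exact Memℓp.const_smul ha c }
  toFun :=
    { toFun := fun ψ => ⟨S fun n => ψ.1 n, ψ.2⟩
      map_add' := fun a b => Subtype.ext (map_add S (fun n => a.1 n) (fun n => b.1 n))
      map_smul' := fun c a => Subtype.ext (map_smul S c (fun n => a.1 n)) }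

/-- The creation operator `a_j†` of mode `j`, as an unbounded operator with its maximal domain.
It is determined by `a_j† |n⟩ = √(n_j + 1) |n + e_j⟩`, that is,
`(a_j† ψ)(n) = √n_j ψ(n - e_j)`, which is `0` when `n_j = 0`. -/
noncomputable def creation (j : Fin m) : FockSpace m →ₗ.[ℂ] FockSpace m :=
  maximalOperator
    { toFun := fun f n => (√(n j : ℝ) : ℂ) * f (n - Pi.single j 1)
      map_add' := fun f g => by funext n; simp [mul_add]
      map_smul' := fun c f => by funext n; simp; ring }

/-- The annihilation operator `a_j` of mode `j`, as an unbounded operator with its maximal domain.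
It is determined by `a_j |n⟩ = √n_j |n - e_j⟩`, that is, `(a_j ψ)(n) = √(n_j + 1) ψ(n + e_j)`. -/
noncomputable def annihilation (j : Fin m) : FockSpace m →ₗ.[ℂ] FockSpace m :=
  maximalOperator
    { toFun := fun f n => (√((n j : ℝ) + 1) : ℂ) * f (n + Pi.single j 1)
      map_add' := fun f g => by funext n; simp [mul_add]
      map_smul' := fun c f => by funext n; simp; ring }

/-- Finite-particle vectors lie in the domain of every creation operator. -/
theorem finiteVectors_le_creation_domain (j : Fin m) :
    finiteVectors m ≤ (creation j).domain := by
  intro ψ hψ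
  have hfin : (Function.support fun n => ψ n).Finite := hψ
  have h0 : Memℓp (fun n : Fin m → ℕ => (√(n j : ℝ) : ℂ) * ψ (n - Pi.single j 1)) 0 := by
    apply memℓp_zero
    refine (hfin.image (fun n => n + Pi.single j 1)).subset ?_
    intro n hn
    have hn' : (√(n j : ℝ) : ℂ) * ψ (n - Pi.single j 1) ≠ 0 := hn
    refine ⟨n - Pi.single j 1, right_ne_zero_of_mul hn', ?_⟩
    have hj : n j ≠ 0 := by
      intro h
      exact left_ne_zero_of_mul hn' (by simp [h])
    funext i
    by_cases hi : i = j
    · subst hi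
      simp
      omega
    · simp [hi]
  exact h0.of_exponent_ge (by simp)

/-- `IsExp A T` says that the bounded operator `T` is the exponential of the unbounded operator
`A`: on each finite-particle vector `ψ` all the iterates `A^n ψ` are defined and
`T ψ = ∑ n, A^n ψ / n!`, with convergence in norm. Since finite-particle vectors are dense, there
is at most one such `T`. -/
def IsExp (A : FockSpace m →ₗ.[ℂ] FockSpace m) (T : FockSpace m →L[ℂ] FockSpace m) : Prop :=
  ∀ ψ ∈ finiteVectors m, ∃ φ : ℕ → FockSpace m,
    φ 0 = ψ ∧ (∀ n, ∃ h : φ n ∈ A.domain, A ⟨φ n, h⟩ = φ (n + 1)) ∧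
      HasSum (fun n => ((n.factorial : ℂ)⁻¹) • φ n) (T ψ)

open Classical in
/-- The exponential of an unbounded operator, in the sense of `IsExp` (and `0` if there is none). -/
noncomputable def opExp (A : FockSpace m →ₗ.[ℂ] FockSpace m) : FockSpace m →L[ℂ] FockSpace m :=
  if h : ∃ T, IsExp A T then h.choose else 0

/-- The generator `α a_j† - α* a_j`. -/
noncomputable def displacementGenerator (j : Fin m) (α : ℂ) : FockSpace m →ₗ.[ℂ] FockSpace m :=
  α • creation j - conj α • annihilation j

/-- The displacement operator `D_j(α) = exp (α a_j† - α* a_j)` on mode `j`. -/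
noncomputable def displacement (j : Fin m) (α : ℂ) : FockSpace m →L[ℂ] FockSpace m :=
  opExp (displacementGenerator j α)

/-- The product `D_1(α_1) D_2(α_2) ⋯ D_m(α_m)`. -/
noncomputable def displacementProd (α : Fin m → ℂ) : FockSpace m →L[ℂ] FockSpace m :=
  (List.ofFn fun j => displacement j (α j)).prod

/-- The unitary `W` evolves the creation operators linearly with coefficient matrix `V`:
`W a_j† W† ψ = ∑ k, V_{j,k} a_k† ψ` for every mode `j` and every finite-particle vector `ψ`. -/
def EvolvesCreation (V : Matrix (Fin m) (Fin m) ℂ)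
    (W : unitary (FockSpace m →L[ℂ] FockSpace m)) : Prop :=
  ∀ (j : Fin m) (ψ : FockSpace m) (hψ : ψ ∈ finiteVectors m),
    ∃ h : (star W).1 ψ ∈ (creation j).domain,
      W.1 (creation j ⟨(star W).1 ψ, h⟩) =
        ∑ k, V j k • creation k ⟨ψ, finiteVectors_le_creation_domain k hψ⟩

end FockSpace

/-!
The finite-particle vectors `F₀` are a dense subspace on which creation and annihilation operators
are endomorphisms, formally adjoint to each other. A generator `X = ∑ j, λ_j a_j† - λ_j* a_j` is
skew-symmetric on `F₀`, raises the particle number by at most one and is bounded by `C √(N + 1)` on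
vectors with at most `N` particles, so that `‖X ^ n ψ‖ ≤ K (2 C) ^ n √n!` for `ψ ∈ F₀`: its
exponential series converges absolutely on `F₀` (`IsParticleBounded.hasEntireVectors`).

Pairing two such series and moving `X` across the inner product gives `∑ N, (1 - 1) ^ N / N! …`, of
which only the constant term survives (`inner_expSeries_eq`). Applied to two vectors of `F₀` this
says that the exponential is isometric, hence extends to a unitary (`exists_unitary_isExpOn`).
Applied to one vector of `F₀` and a sequence `v n` of weak iterates it says that the unitary is
given by its exponential series also at `v 0`, which need not lie in `F₀`
(`IsExpOn.hasSum_of_weak`). Generators of different modes commute, so the product of displacement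
operators is the exponential of the sum of the generators (`isExpOn_displacementProd`).

Let `W` evolve the creation operators by `V`. The domain of `a_j†` is contained in that of `a_j`, so
taking adjoints shows that `W` evolves the annihilation operators by the conjugate of `V`. Hence
`W† (Y ^ n ψ)`, with `Y` the generator for `μ_k = ∑ j, V_{j,k} λ_j` and `ψ ∈ F₀`, are weak iterates
of `X` at `W† ψ`, and summing the two exponential series gives `D(λ) W† ψ = W† D(μ) ψ`
(`EvolvesCreation.mul_displacementProd_mul_star`). Working with weak iterates makes it unnecessary
to know that `W† ψ` has finitely many particles.

For the existence and uniqueness of `W`, identify `F₀` with the polynomials in `m` variables, the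
monomial `X^n` corresponding to `√(n!) |n⟩`. Creation is multiplication by `X_j`, annihilation is
`∂_j`, and a vacuum-preserving `W` has to act as the substitution `X_j ↦ ∑ k, V_{j,k} X_k`. By the
chain rule the adjoint of this substitution is the substitution for the conjugate transpose of `V`
(`inner_ofPoly_linearSubst`), so it is isometric and invertible when `V` is unitary.
-/

/-! ### Sums over antidiagonals -/

theorem HasSum.antidiagonal {E : Type*} [NormedAddCommGroup E] [CompleteSpace E]
    {f : ℕ × ℕ → E} {s : E} (hf : HasSum f s) :
    HasSum (fun N => ∑ p ∈ Finset.HasAntidiagonal.antidiagonal N, f p) s := by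
  have h : HasSum (fun x : Σ N : ℕ, Finset.HasAntidiagonal.antidiagonal N => f x.2.1) s :=
    (Finset.HasAntidiagonal.sigmaAntidiagonalEquivProd (A := ℕ)).hasSum_iff.2 hf
  refine h.sigma fun N => ?_
  rw [← Finset.sum_coe_sort (Finset.HasAntidiagonal.antidiagonal N) f]
  exact hasSum_fintype _

/-- The binomial theorem, with each power divided by its factorial. -/
theorem Commute.sum_antidiagonal_inv_factorial_smul {A : Type*} [Ring A] [Algebra ℂ A] {a b : A}
    (h : Commute a b) (N : ℕ) :
    ∑ p ∈ Finset.HasAntidiagonal.antidiagonal N,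
        ((p.1.factorial : ℂ)⁻¹ * (p.2.factorial : ℂ)⁻¹) • (a ^ p.1 * b ^ p.2) =
      (N.factorial : ℂ)⁻¹ • (a + b) ^ N := by
  rw [h.add_pow', Finset.smul_sum]
  refine Finset.sum_congr rfl fun p hp => ?_
  rw [← Nat.cast_smul_eq_nsmul ℂ, smul_smul]
  congr 1
  rw [Finset.HasAntidiagonal.mem_antidiagonal] at hp
  subst hp
  rw [Nat.cast_add_choose]
  have := Nat.cast_ne_zero (R := ℂ).2 (p.1 + p.2).factorial_ne_zero
  field_simp

/-! ### Exponentials of skew-symmetric operators -/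

section Exponential

variable {H : Type*} [NormedAddCommGroup H] [InnerProductSpace ℂ H]

/-- Two exponential series whose coefficients are moved across the inner product at the cost of a
sign pair to their constant term: the terms of total degree `N` add up to `(1 - 1) ^ N / N!`. -/
theorem inner_expSeries_eq [CompleteSpace H] {φ v : ℕ → H} {s t : H}
    (hφ : Summable fun n => ‖(n.factorial : ℂ)⁻¹ • φ n‖)
    (hv : Summable fun n => ‖(n.factorial : ℂ)⁻¹ • v n‖)
    (hs : HasSum (fun n => (n.factorial : ℂ)⁻¹ • φ n) s)
    (ht : HasSum (fun n => (n.factorial : ℂ)⁻¹ • v n) t)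
    (h : ∀ n k, inner ℂ (φ (n + 1)) (v k) = -inner ℂ (φ n) (v (k + 1))) :
    inner ℂ s t = inner ℂ (φ 0) (v 0) := by
  have hmove : ∀ n k, inner ℂ (φ n) (v k) = (-1) ^ n * inner ℂ (φ 0) (v (n + k)) := by
    intro n
    induction n with
    | zero => simp
    | succ n ih =>
      intro k
      rw [h, ih, pow_succ, show n + 1 + k = n + (k + 1) by ring]
      ring
  set f : ℕ × ℕ → ℂ := fun p =>
    inner ℂ ((p.1.factorial : ℂ)⁻¹ • φ p.1) ((p.2.factorial : ℂ)⁻¹ • v p.2) with hf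
  have hsum : Summable f :=
    Summable.of_norm_bounded (hφ.mul_of_nonneg hv (fun _ => norm_nonneg _) fun _ => norm_nonneg _)
      fun p => norm_inner_le_norm _ _
  have hfst : HasSum f (inner ℂ s t) := by
    have h1 : ∀ n, HasSum (fun k => f (n, k)) (inner ℂ ((n.factorial : ℂ)⁻¹ • φ n) t) :=
      fun n => ht.mapL (innerSL ℂ ((n.factorial : ℂ)⁻¹ • φ n))
    have h2 : HasSum (fun n => inner ℂ ((n.factorial : ℂ)⁻¹ • φ n) t) (inner ℂ s t) := by
      exact hs.mapL (innerSLFlip ℂ t)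
    have h3 := hsum.hasSum
    rwa [(h3.prod_fiberwise h1).unique h2] at h3
  refine hfst.antidiagonal.unique ?_
  have hterm : ∀ N, ∑ p ∈ Finset.HasAntidiagonal.antidiagonal N, f p =
      ((N.factorial : ℂ)⁻¹ * (0 : ℂ) ^ N) * inner ℂ (φ 0) (v N) := by
    intro N
    have := (Commute.all (-1 : ℂ) 1).sum_antidiagonal_inv_factorial_smul N
    rw [neg_add_cancel, smul_eq_mul] at this
    rw [← this, Finset.sum_mul]
    refine Finset.sum_congr rfl fun p hp => ?_
    rw [hf]
    simp only [inner_smul_left, inner_smul_right, hmove p.1 p.2,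
      Finset.HasAntidiagonal.mem_antidiagonal.1 hp]
    simp
    ring
  simp only [hterm]
  have hite : (fun N => ((N.factorial : ℂ)⁻¹ * (0 : ℂ) ^ N) * inner ℂ (φ 0) (v N)) =
      fun N => if N = 0 then inner ℂ (φ 0) (v 0) else 0 := by
    funext N
    rcases eq_or_ne N 0 with rfl | hN
    · simp
    · simp [hN]
  rw [hite]
  exact hasSum_ite_eq 0 _

variable {F : Submodule ℂ H}

/-- The bounded operator `T` is the sum of the exponential series of `X` on the vectors of `F`, the
domain of `X`. -/
def IsExpOn (X : Module.End ℂ F) (T : H →L[ℂ] H) : Prop :=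
  ∀ ψ : F, HasSum (fun n => (n.factorial : ℂ)⁻¹ • ((X ^ n) ψ : H)) (T ψ)

/-- Every vector of `F` is an entire vector of `X`: the exponential series of `X` converges
absolutely on `F`. -/
def HasEntireVectors (X : Module.End ℂ F) : Prop :=
  ∀ ψ : F, Summable fun n => ‖(n.factorial : ℂ)⁻¹ • ((X ^ n) ψ : H)‖

/-- `X` is skew-symmetric on its domain `F`. -/
def IsSkew (X : Module.End ℂ F) : Prop :=
  ∀ φ ψ : F, inner ℂ (X φ : H) (ψ : H) = -inner ℂ (φ : H) (X ψ : H)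

theorem ContinuousLinearMap.eq_of_eqOn_dense_submodule (hF : Dense (F : Set H))
    {S T : H →L[ℂ] H} (h : ∀ ψ : F, S ψ = T ψ) : S = T :=
  ContinuousLinearMap.coeFn_injective <|
    S.continuous.ext_on hF T.continuous fun ψ hψ => h ⟨ψ, hψ⟩

theorem IsExpOn.unique (hF : Dense (F : Set H)) {X : Module.End ℂ F} {S T : H →L[ℂ] H}
    (hS : IsExpOn X S) (hT : IsExpOn X T) : S = T :=
  ContinuousLinearMap.eq_of_eqOn_dense_submodule hF fun ψ => (hS ψ).unique (hT ψ)

/-- Two isometries on a dense subspace that are formally adjoint to each other extend to a unitary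
and its adjoint. -/
theorem exists_unitary_extension [CompleteSpace H] (hF : Dense (F : Set H)) (T S : F →ₗ[ℂ] H)
    (hT : ∀ φ, ‖T φ‖ = ‖φ‖) (hS : ∀ φ, ‖S φ‖ = ‖φ‖)
    (hTS : ∀ φ ψ : F, inner ℂ (T φ) (ψ : H) = inner ℂ (φ : H) (S ψ)) :
    ∃ W : unitary (H →L[ℂ] H), (∀ φ : F, W.1 φ = T φ) ∧ ∀ φ : F, (star W).1 φ = S φ := by
  have hd : DenseRange F.subtype := by simpa [DenseRange] using hF
  set A := T.extendOfNorm F.subtype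
  set B := S.extendOfNorm F.subtype
  have hA : ∀ φ : F, A φ = T φ :=
    LinearMap.extendOfNorm_eq hd ⟨1, fun φ => by simp [hT]⟩
  have hB : ∀ φ : F, B φ = S φ :=
    LinearMap.extendOfNorm_eq hd ⟨1, fun φ => by simp [hS]⟩
  have isom : ∀ C : H →L[ℂ] H, (∀ φ : F, ‖C φ‖ = ‖φ‖) → star C * C = 1 := by
    intro C hC
    have hC' : ∀ x, ‖C x‖ = ‖x‖ := fun x => congrFun
      (C.continuous.norm.ext_on hF continuous_norm fun φ hφ => hC ⟨φ, hφ⟩) x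
    exact (ContinuousLinearMap.norm_map_iff_adjoint_comp_self C).1 hC'
  have hadj : star A = B := by
    refine ContinuousLinearMap.eq_of_eqOn_dense_submodule hF fun ψ => ?_
    refine hF.eq_of_inner_right ℂ fun φ hφ => ?_
    rw [ContinuousLinearMap.star_eq_adjoint, ContinuousLinearMap.adjoint_inner_right, hB]
    exact (hA ⟨φ, hφ⟩).symm ▸ hTS ⟨φ, hφ⟩ ψ
  have hAA : star A * A = 1 := isom A fun φ => by rw [hA, hT]
  have hBB : star B * B = 1 := isom B fun φ => by rw [hB, hS]
  refine ⟨⟨A, hAA, ?_⟩, hA, fun φ => ?_⟩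
  · rwa [← hadj, star_star] at hBB
  · exact (congrArg (fun C : H →L[ℂ] H => C φ) hadj).trans (hB φ)

theorem HasEntireVectors.neg {X : Module.End ℂ F} (hX : HasEntireVectors X) :
    HasEntireVectors (-X) := by
  intro ψ
  refine (hX ψ).congr fun n => ?_
  rcases Nat.even_or_odd n with hn | hn
  · rw [show (-X) ^ n = X ^ n from hn.neg_pow X]
  · rw [show (-X) ^ n = -X ^ n from hn.neg_pow X]
    simp

theorem IsSkew.neg {X : Module.End ℂ F} (hX : IsSkew X) : IsSkew (-X) := by
  intro φ ψ
  simp [hX φ ψ]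

/-- The exponential of a skew-symmetric operator with a dense set of entire vectors, its domain, is
unitary. -/
theorem exists_unitary_isExpOn [CompleteSpace H] (hF : Dense (F : Set H)) {X : Module.End ℂ F}
    (hX : IsSkew X) (he : HasEntireVectors X) : ∃ T ∈ unitary (H →L[ℂ] H), IsExpOn X T := by
  let E : ∀ Y : Module.End ℂ F, HasEntireVectors Y → (F →ₗ[ℂ] H) := fun Y hY =>
    { toFun := fun ψ => ∑' n, (n.factorial : ℂ)⁻¹ • ((Y ^ n) ψ : H)
      map_add' := fun φ ψ => by
        rw [← ((hY φ).of_norm).tsum_add (hY ψ).of_norm]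
        simp
      map_smul' := fun c ψ => by
        simp only [map_smul, Submodule.coe_smul, smul_comm _ c, RingHom.id_apply]
        exact (hY ψ).of_norm.tsum_const_smul c }
  have hE : ∀ Y hY ψ, HasSum (fun n => (n.factorial : ℂ)⁻¹ • ((Y ^ n) ψ : H)) (E Y hY ψ) :=
    fun Y hY ψ => (hY ψ).of_norm.hasSum
  have hnorm : ∀ Y hY, IsSkew Y → ∀ ψ, ‖E Y hY ψ‖ = ‖ψ‖ := by
    intro Y hY hs ψ
    have h := inner_expSeries_eq (hY ψ) (hY ψ) (hE Y hY ψ) (hE Y hY ψ) fun n k => by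
      rw [pow_succ', pow_succ']
      exact hs _ _
    rw [inner_self_eq_norm_sq_to_K, inner_self_eq_norm_sq_to_K] at h
    have h' : ‖E Y hY ψ‖ ^ 2 = ‖ψ‖ ^ 2 := by exact_mod_cast h
    exact (pow_left_inj₀ (norm_nonneg _) (norm_nonneg _) two_ne_zero).1 h'
  have hadj : ∀ φ ψ : F, inner ℂ (E X he φ) (ψ : H) = inner ℂ (φ : H) (E (-X) he.neg ψ) := by
    intro φ ψ
    have hmove : ∀ n, ∀ φ ψ : F,
        inner ℂ ((X ^ n) φ : H) (ψ : H) = inner ℂ (φ : H) (((-X) ^ n) ψ : H) := by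
      intro n
      induction n with
      | zero => simp
      | succ n ih =>
        intro φ ψ
        rw [pow_succ, pow_succ', Module.End.mul_apply, Module.End.mul_apply, ih, hX]
        simp
    refine ((hE X he φ).mapL (innerSLFlip ℂ (ψ : H))).unique ?_
    convert (hE (-X) he.neg ψ).mapL (innerSL ℂ (φ : H)) using 2 with n
    · simp [hmove]
    · rfl
  obtain ⟨W, hW, -⟩ := exists_unitary_extension hF (E X he) (E (-X) he.neg) (hnorm X he hX)
    (hnorm _ he.neg hX.neg) hadj
  exact ⟨W, W.2, fun ψ => by rw [hW]; exact hE X he ψ⟩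

/-- A unitary exponential is given by the exponential series also at vectors `v 0` outside the
domain of `X`, as long as the iterates `v n` of the weak extension (the adjoint of `-X`) exist and
the series converges absolutely. -/
theorem IsExpOn.hasSum_of_weak [CompleteSpace H] (hF : Dense (F : Set H)) {X : Module.End ℂ F}
    {T : H →L[ℂ] H} (hT : IsExpOn X T) (hu : T ∈ unitary (H →L[ℂ] H)) (he : HasEntireVectors X)
    {v : ℕ → H} (hv : Summable fun n => ‖(n.factorial : ℂ)⁻¹ • v n‖)
    (h : ∀ (φ : F) n, inner ℂ (X φ : H) (v n) = -inner ℂ (φ : H) (v (n + 1))) :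
    HasSum (fun n => (n.factorial : ℂ)⁻¹ • v n) (T (v 0)) := by
  obtain ⟨t, ht⟩ := hv.of_norm
  have key : star T t = v 0 := by
    refine hF.eq_of_inner_right ℂ fun φ hφ => ?_
    rw [ContinuousLinearMap.star_eq_adjoint, ContinuousLinearMap.adjoint_inner_right]
    refine inner_expSeries_eq (he ⟨φ, hφ⟩) hv (hT ⟨φ, hφ⟩) ht fun n k => ?_
    rw [pow_succ']
    exact h _ _
  have hTT : T (star T t) = t :=
    congrArg (fun C : H →L[ℂ] H => C t) (Unitary.mul_star_self_of_mem hu)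
  rwa [← key, hTT]
/-- Exponentials of commuting operators multiply. -/
theorem IsExpOn.mul [CompleteSpace H] {X Y : Module.End ℂ F} {S T : H →L[ℂ] H}
    (hS : IsExpOn X S) (hT : IsExpOn Y T) (hXY : Commute X Y)
    (hsum : ∀ ψ : F, Summable fun p : ℕ × ℕ =>
      ‖((p.1.factorial : ℂ)⁻¹ * (p.2.factorial : ℂ)⁻¹) • ((X ^ p.1 * Y ^ p.2) ψ : H)‖) :
    IsExpOn (X + Y) (S * T) := by
  intro ψ
  set f : ℕ × ℕ → H := fun p =>
    ((p.1.factorial : ℂ)⁻¹ * (p.2.factorial : ℂ)⁻¹) • ((X ^ p.1 * Y ^ p.2) ψ : H) with hf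
  have hs : HasSum f (∑' p, f p) := (Summable.of_norm (hsum ψ)).hasSum
  have h0 : ∀ k, HasSum (fun n => f (n, k)) ((k.factorial : ℂ)⁻¹ • S ((Y ^ k) ψ)) := by
    intro k
    refine ((hS ((Y ^ k) ψ)).const_smul (k.factorial : ℂ)⁻¹).congr_fun fun n => ?_
    rw [smul_smul, mul_comm]
    rfl
  have h1 := ((Equiv.prodComm ℕ ℕ).hasSum_iff.2 hs).prod_fiberwise h0
  have h2 : HasSum (fun k => (k.factorial : ℂ)⁻¹ • S ((Y ^ k) ψ)) (S (T ψ)) := by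
    simpa using (hT ψ).mapL S
  have h3 := hs.antidiagonal
  rw [h1.unique h2] at h3
  refine h3.congr_fun fun N => ?_
  have h4 := congrArg (fun Z : Module.End ℂ F => ((Z ψ : F) : H))
    (hXY.sum_antidiagonal_inv_factorial_smul N)
  rw [LinearMap.sum_apply] at h4
  simpa [hf] using h4.symm

end Exponential

namespace FockSpace

variable {m : ℕ}

/-! ### Creation and annihilation operators on finite-particle vectors -/

theorem creation_apply (j : Fin m) (ψ : (creation j).domain) (n : Fin m → ℕ) :
    creation j ψ n = (√(n j : ℝ) : ℂ) * ψ.1 (n - Pi.single j 1) := rfl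

theorem annihilation_apply (j : Fin m) (ψ : (annihilation j).domain) (n : Fin m → ℕ) :
    annihilation j ψ n = (√((n j : ℝ) + 1) : ℂ) * ψ.1 (n + Pi.single j 1) := rfl

theorem sub_single_add_single {n : Fin m → ℕ} {j : Fin m} (h : n j ≠ 0) :
    n - Pi.single j 1 + Pi.single j 1 = n := by
  funext i
  rcases eq_or_ne i j with rfl | hi
  · simp
    omega
  · simp [hi]

theorem sum_add_single (n : Fin m → ℕ) (j : Fin m) :
    ∑ i, (n + Pi.single j 1 : Fin m → ℕ) i = ∑ i, n i + 1 := by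
  simp [Finset.sum_add_distrib]

theorem dense_finiteVectors : Dense (finiteVectors m : Set (FockSpace m)) := by
  intro ψ
  refine mem_closure_of_tendsto (lp.hasSum_single (by simp) ψ) (.of_forall fun s => ?_)
  refine (finiteVectors m).sum_mem fun n _ => ?_
  refine (Set.finite_singleton n).subset fun k hk => ?_
  by_contra hne
  exact hk (lp.single_apply_ne 2 n _ hne)

/-- The maximal domain of a creation operator is contained in that of the annihilation operator of
the same mode: `|(a_j ψ)(n)| ≤ |(a_j† ψ)(n + 2 e_j)|`. -/
theorem creation_domain_le (j : Fin m) : (creation j).domain ≤ (annihilation j).domain := by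
  intro ψ hψ
  have hs : Summable fun n : Fin m → ℕ =>
      ‖(√(n j : ℝ) : ℂ) * ψ (n - Pi.single j 1)‖ ^ (2 : ENNReal).toReal :=
    (memℓp_gen_iff (by simp)).1 (show Memℓp (E := fun _ : Fin m → ℕ => ℂ) _ 2 from hψ)
  have hinj : Function.Injective fun n : Fin m → ℕ => n + Pi.single j 1 + Pi.single j 1 :=
    fun a b h => by simpa using h
  show Memℓp (E := fun _ : Fin m → ℕ => ℂ)
    (fun n => (√((n j : ℝ) + 1) : ℂ) * ψ (n + Pi.single j 1)) 2
  refine (memℓp_gen_iff (by simp)).2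
    (.of_nonneg_of_le (fun _ => by positivity) (fun n => ?_) (hs.comp_injective hinj))
  refine Real.rpow_le_rpow (norm_nonneg _) ?_ (by simp)
  rw [norm_mul, add_tsub_cancel_right, norm_mul, Complex.norm_real, Complex.norm_real,
    Real.norm_of_nonneg (Real.sqrt_nonneg _), Real.norm_of_nonneg (Real.sqrt_nonneg _)]
  gcongr
  simp

/-- On their maximal domains, `a_j` and `a_j†` are formally adjoint. -/
theorem inner_creation (j : Fin m) (φ : (creation j).domain) (v : (annihilation j).domain) :
    inner ℂ (creation j φ) v.1 = inner ℂ φ.1 (annihilation j v) := by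
  rw [lp.inner_eq_tsum, lp.inner_eq_tsum]
  have hinj : Function.Injective fun n : Fin m → ℕ => n + Pi.single j 1 :=
    fun a b h => by simpa using h
  rw [← hinj.tsum_eq]
  · refine tsum_congr fun n => ?_
    rw [creation_apply, annihilation_apply, add_tsub_cancel_right]
    simp
    ring
  · intro n hn
    refine ⟨n - Pi.single j 1, sub_single_add_single fun h => hn ?_⟩
    simp [creation_apply, h]

theorem finiteVectors_le_annihilation_domain (j : Fin m) :
    finiteVectors m ≤ (annihilation j).domain :=
  (finiteVectors_le_creation_domain j).trans (creation_domain_le j)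

/-- The creation operator `a_j†` as an endomorphism of the finite-particle vectors. -/
noncomputable def create (j : Fin m) : Module.End ℂ (finiteVectors m) :=
  ((creation j).toFun.comp (Submodule.inclusion (finiteVectors_le_creation_domain j))).codRestrict
    (finiteVectors m) fun ψ => by
      refine (Set.Finite.image (fun n => n + Pi.single j 1) ψ.2).subset fun n hn => ?_
      have hn' : (√(n j : ℝ) : ℂ) * ψ.1 (n - Pi.single j 1) ≠ 0 := hn
      exact ⟨n - Pi.single j 1, right_ne_zero_of_mul hn',
        sub_single_add_single fun h => hn' (by simp [h])⟩

/-- The annihilation operator `a_j` as an endomorphism of the finite-particle vectors. -/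
noncomputable def annihilate (j : Fin m) : Module.End ℂ (finiteVectors m) :=
  ((annihilation j).toFun.comp
    (Submodule.inclusion (finiteVectors_le_annihilation_domain j))).codRestrict
    (finiteVectors m) fun ψ => by
      refine (Set.Finite.image (fun n => n - Pi.single j 1) ψ.2).subset fun n hn => ?_
      have hn' : (√((n j : ℝ) + 1) : ℂ) * ψ.1 (n + Pi.single j 1) ≠ 0 := hn
      exact ⟨n + Pi.single j 1, right_ne_zero_of_mul hn', add_tsub_cancel_right _ _⟩

theorem coe_create (j : Fin m) (ψ : finiteVectors m) :
    (create j ψ : FockSpace m) = creation j ⟨ψ, finiteVectors_le_creation_domain j ψ.2⟩ := rfl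

theorem create_apply (j : Fin m) (ψ : finiteVectors m) (n : Fin m → ℕ) :
    (create j ψ).1 n = (√(n j : ℝ) : ℂ) * ψ.1 (n - Pi.single j 1) := rfl

theorem annihilate_apply (j : Fin m) (ψ : finiteVectors m) (n : Fin m → ℕ) :
    (annihilate j ψ).1 n = (√((n j : ℝ) + 1) : ℂ) * ψ.1 (n + Pi.single j 1) := rfl

theorem finiteVectors_ext {φ ψ : finiteVectors m} (h : ∀ n, φ.1 n = ψ.1 n) : φ = ψ :=
  Subtype.ext (lp.ext (funext h))

theorem inner_create (j : Fin m) (φ ψ : finiteVectors m) :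
    inner ℂ (create j φ : FockSpace m) (ψ : FockSpace m) =
      inner ℂ (φ : FockSpace m) (annihilate j ψ : FockSpace m) :=
  inner_creation j ⟨φ, finiteVectors_le_creation_domain j φ.2⟩
    ⟨ψ, finiteVectors_le_annihilation_domain j ψ.2⟩

theorem inner_annihilate (j : Fin m) (φ ψ : finiteVectors m) :
    inner ℂ (annihilate j φ : FockSpace m) (ψ : FockSpace m) =
      inner ℂ (φ : FockSpace m) (create j ψ : FockSpace m) := by
  rw [← inner_conj_symm, ← inner_create, inner_conj_symm]

theorem annihilate_create_apply (j : Fin m) (ψ : finiteVectors m) (n : Fin m → ℕ) :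
    (annihilate j (create j ψ)).1 n = ((n j : ℂ) + 1) * ψ.1 n := by
  rw [annihilate_apply, create_apply, add_tsub_cancel_right, ← mul_assoc, ← Complex.ofReal_mul]
  simp only [Pi.add_apply, Pi.single_eq_same, Nat.cast_add, Nat.cast_one]
  rw [Real.mul_self_sqrt (by positivity)]
  simp

theorem create_annihilate_apply (j : Fin m) (ψ : finiteVectors m) (n : Fin m → ℕ) :
    (create j (annihilate j ψ)).1 n = (n j : ℂ) * ψ.1 n := by
  rw [create_apply, annihilate_apply]
  rcases eq_or_ne (n j) 0 with h | h
  · simp [h]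
  · have h1 : ((n - Pi.single j 1 : Fin m → ℕ) j : ℝ) + 1 = n j := by
      rw [Pi.sub_apply, Pi.single_eq_same]
      exact_mod_cast Nat.sub_add_cancel (Nat.pos_of_ne_zero h)
    rw [h1, sub_single_add_single h, ← mul_assoc, ← Complex.ofReal_mul,
      Real.mul_self_sqrt (by positivity)]
    simp

theorem commute_create {i j : Fin m} (hij : i ≠ j) : Commute (create i) (create j) := by
  refine LinearMap.ext fun ψ => finiteVectors_ext fun n => ?_
  simp only [Module.End.mul_apply, create_apply, Pi.sub_apply, Pi.single_eq_of_ne hij,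
    Pi.single_eq_of_ne hij.symm, tsub_zero]
  rw [tsub_right_comm]
  ring

theorem commute_annihilate {i j : Fin m} (hij : i ≠ j) :
    Commute (annihilate i) (annihilate j) := by
  refine LinearMap.ext fun ψ => finiteVectors_ext fun n => ?_
  simp only [Module.End.mul_apply, annihilate_apply, Pi.add_apply, Pi.single_eq_of_ne hij,
    Pi.single_eq_of_ne hij.symm, add_zero]
  rw [add_right_comm]
  ring

theorem commute_create_annihilate {i j : Fin m} (hij : i ≠ j) :
    Commute (create i) (annihilate j) := by
  refine LinearMap.ext fun ψ => finiteVectors_ext fun n => ?_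
  have h : n - Pi.single i 1 + Pi.single j 1 = n + Pi.single j 1 - Pi.single i 1 := by
    funext k
    rcases eq_or_ne k i with rfl | hk
    · simp [hij]
    · simp [hk]
  simp only [Module.End.mul_apply, annihilate_apply, create_apply, Pi.add_apply, Pi.sub_apply,
    Pi.single_eq_of_ne hij, Pi.single_eq_of_ne hij.symm, add_zero, tsub_zero, h]
  ring

/-! ### Particle number bounds -/

/-- The vectors with at most `N` particles. -/
def particlesLE (m N : ℕ) : Submodule ℂ (finiteVectors m) where
  carrier := {ψ | ∀ n : Fin m → ℕ, N < ∑ i, n i → ψ.1 n = 0}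
  zero_mem' := fun _ _ => rfl
  add_mem' := fun {φ ψ} hφ hψ n hn => by simp [hφ n hn, hψ n hn]
  smul_mem' := fun c ψ hψ n hn => by simp [hψ n hn]

theorem exists_mem_particlesLE (ψ : finiteVectors m) : ∃ N, ψ ∈ particlesLE m N := by
  obtain ⟨N, hN⟩ := (Set.Finite.image (fun n : Fin m → ℕ => ∑ i, n i) ψ.2).bddAbove
  refine ⟨N, fun n hn => ?_⟩
  by_contra h
  exact absurd (hN ⟨n, h, rfl⟩) (not_le.2 hn)

/-- `X` raises the particle number by at most one, and on vectors with at most `N` particles it is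
bounded by `C √(N + 1)`. -/
def IsParticleBounded (C : ℝ) (X : Module.End ℂ (finiteVectors m)) : Prop :=
  ∀ N, ∀ ψ ∈ particlesLE m N, X ψ ∈ particlesLE m (N + 1) ∧ ‖X ψ‖ ≤ C * √(N + 1) * ‖ψ‖

/-- If `Y` is the formal adjoint of `X`, a bound on `Y X` gives one on `X`, because
`‖X ψ‖² = ⟨ψ, Y X ψ⟩`. -/
theorem isParticleBounded_of_inner_eq {X Y : Module.End ℂ (finiteVectors m)}
    (hX : ∀ N, ∀ ψ ∈ particlesLE m N, X ψ ∈ particlesLE m (N + 1))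
    (hXY : ∀ φ ψ : finiteVectors m,
      inner ℂ (X φ : FockSpace m) (ψ : FockSpace m) = inner ℂ (φ : FockSpace m) (Y ψ : FockSpace m))
    (hYX : ∀ (ψ : finiteVectors m) n, ‖(Y (X ψ)).1 n‖ ≤ (∑ i, n i + 1) * ‖ψ.1 n‖) :
    IsParticleBounded 1 X := by
  intro N ψ hψ
  refine ⟨hX N ψ hψ, ?_⟩
  have h1 : ‖Y (X ψ)‖ ≤ (N + 1) * ‖ψ‖ := by
    have : ‖(Y (X ψ)).1‖ ≤ ‖((N + 1 : ℂ) • ψ.1)‖ := by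
      refine lp.norm_mono (by simp) fun n => (hYX ψ n).trans ?_
      rcases lt_or_ge N (∑ i, n i) with h | h
      · simp [hψ n h]
      · rw [lp.coeFn_smul, Pi.smul_apply, norm_smul]
        gcongr
        norm_cast
        omega
    refine this.trans (le_of_eq ?_)
    rw [norm_smul]
    congr 1
    norm_cast
  have h2 : ‖X ψ‖ ^ 2 ≤ (√(N + 1) * ‖ψ‖) ^ 2 := by
    have h3 : ‖X ψ‖ ^ 2 = ‖inner ℂ (X ψ : FockSpace m) (X ψ : FockSpace m)‖ := by
      rw [inner_self_eq_norm_sq_to_K]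
      simp
    rw [h3, hXY, mul_pow, Real.sq_sqrt (by positivity)]
    calc _ ≤ ‖ψ‖ * ‖Y (X ψ)‖ := norm_inner_le_norm _ _
      _ ≤ ‖ψ‖ * ((N + 1) * ‖ψ‖) := by gcongr
      _ = _ := by ring
  rw [one_mul]
  exact le_of_sq_le_sq h2 (by positivity)

theorem isParticleBounded_create (j : Fin m) : IsParticleBounded 1 (create j) := by
  refine isParticleBounded_of_inner_eq (fun N ψ hψ n hn => ?_) (inner_create j) fun ψ n => ?_
  · rw [create_apply]
    rcases eq_or_ne (n j) 0 with h | h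
    · simp [h]
    · rw [hψ, mul_zero]
      have := sum_add_single (n - Pi.single j 1) j
      rw [sub_single_add_single h] at this
      omega
  · rw [annihilate_create_apply, norm_mul]
    gcongr
    rw [← Nat.cast_add_one, Complex.norm_natCast, Nat.cast_add_one]
    gcongr
    exact Finset.single_le_sum (fun _ _ => Nat.zero_le _) (Finset.mem_univ j)

theorem isParticleBounded_annihilate (j : Fin m) : IsParticleBounded 1 (annihilate j) := by
  refine isParticleBounded_of_inner_eq (fun N ψ hψ n hn => ?_) (inner_annihilate j) fun ψ n => ?_
  · rw [annihilate_apply, hψ, mul_zero]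
    rw [sum_add_single]
    omega
  · rw [create_annihilate_apply, norm_mul]
    gcongr
    rw [Complex.norm_natCast, ← Nat.cast_add_one]
    gcongr
    exact (Finset.single_le_sum (fun _ _ => Nat.zero_le _) (Finset.mem_univ j)).trans
      (Nat.le_succ _)

theorem IsParticleBounded.add {C D : ℝ} {X Y : Module.End ℂ (finiteVectors m)}
    (hX : IsParticleBounded C X) (hY : IsParticleBounded D Y) :
    IsParticleBounded (C + D) (X + Y) := by
  intro N ψ hψ
  refine ⟨add_mem (hX N ψ hψ).1 (hY N ψ hψ).1, (norm_add_le _ _).trans ?_⟩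
  rw [add_mul, add_mul]
  exact add_le_add (hX N ψ hψ).2 (hY N ψ hψ).2

theorem IsParticleBounded.smul {C : ℝ} {X : Module.End ℂ (finiteVectors m)}
    (hX : IsParticleBounded C X) (c : ℂ) : IsParticleBounded (‖c‖ * C) (c • X) := by
  intro N ψ hψ
  refine ⟨Submodule.smul_mem _ c (hX N ψ hψ).1, ?_⟩
  rw [LinearMap.smul_apply, norm_smul, mul_assoc, mul_assoc]
  gcongr
  exact (mul_assoc C _ _ ▸ (hX N ψ hψ).2)

theorem IsParticleBounded.mono {C D : ℝ} {X : Module.End ℂ (finiteVectors m)}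
    (hX : IsParticleBounded C X) (h : C ≤ D) : IsParticleBounded D X := by
  intro N ψ hψ
  refine ⟨(hX N ψ hψ).1, (hX N ψ hψ).2.trans ?_⟩
  gcongr

theorem IsParticleBounded.pow {C : ℝ} (hC : 0 ≤ C) {X : Module.End ℂ (finiteVectors m)}
    (hX : IsParticleBounded C X) {N : ℕ} {ψ : finiteVectors m} (hψ : ψ ∈ particlesLE m N) (n : ℕ) :
    (X ^ n) ψ ∈ particlesLE m (N + n) ∧
      ‖(X ^ n) ψ‖ ≤ C ^ n * √((N + 1).ascFactorial n) * ‖ψ‖ := by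
  induction n with
  | zero => simpa using hψ
  | succ n ih =>
    rw [pow_succ', Module.End.mul_apply]
    refine ⟨(hX _ _ ih.1).1, (hX _ _ ih.1).2.trans ?_⟩
    calc _ ≤ C * √((N + n : ℕ) + 1) * (C ^ n * √((N + 1).ascFactorial n) * ‖ψ‖) := by
          gcongr
          exact ih.2
      _ = _ := by
          rw [Nat.ascFactorial_succ, Nat.cast_mul, Real.sqrt_mul (by positivity)]
          push_cast
          ring_nf

/-! ### Entire vectors -/

theorem summable_pow_div_sqrt_factorial (r : ℝ) :
    Summable fun n : ℕ => r ^ n / √n.factorial := by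
  have h : Summable fun n : ℕ => ((4 * r ^ 2) ^ n / n.factorial + (1 / 4 : ℝ) ^ n) / 2 :=
    ((Real.summable_pow_div_factorial _).add
      (summable_geometric_of_lt_one (by norm_num) (by norm_num))).div_const 2
  refine Summable.of_norm_bounded h fun n => ?_
  -- the inequality `2 x y ≤ x² + y²` for `x = (2 |r|)^n / √n!` and `y = 2⁻ⁿ`
  have h1 : ‖r ^ n / √n.factorial‖ = (2 * |r|) ^ n / √n.factorial * (1 / 2) ^ n := by
    rw [norm_div, norm_pow, Real.norm_eq_abs, Real.norm_of_nonneg (Real.sqrt_nonneg _), mul_pow,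
      one_div, inv_pow]
    field_simp
  have h2 : (4 * r ^ 2) ^ n / n.factorial = ((2 * |r|) ^ n / √n.factorial) ^ 2 := by
    rw [div_pow, Real.sq_sqrt (by positivity), ← pow_mul, mul_comm n, pow_mul, mul_pow 2, sq_abs]
    norm_num
  have h3 : (1 / 4 : ℝ) ^ n = ((1 / 2) ^ n) ^ 2 := by
    rw [← pow_mul, mul_comm, pow_mul]
    norm_num
  rw [h1, h2, h3]
  linarith [two_mul_le_add_sq ((2 * |r|) ^ n / √n.factorial) ((1 / 2 : ℝ) ^ n)]

theorem ascFactorial_add_le (N n k : ℕ) :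
    (N + 1).ascFactorial (k + n) ≤ 2 ^ N * (4 ^ n * n.factorial) * (4 ^ k * k.factorial) := by
  rw [Nat.ascFactorial_eq_factorial_mul_choose,
    ← Nat.add_choose_mul_factorial_mul_factorial k n]
  calc _ ≤ 2 ^ (k + n) * k.factorial * n.factorial * 2 ^ (N + (k + n)) := by
        gcongr <;> exact Nat.choose_le_two_pow _ _
    _ = _ := by
        rw [show 4 = 2 * 2 by rfl, mul_pow, mul_pow]
        ring

/-- The double exponential series of two particle-bounded operators converges absolutely, because
`(N + n + k)! / N! ≤ 2 ^ N (4 ^ n n!) (4 ^ k k!)`. -/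
theorem IsParticleBounded.summable_pow_mul_pow {C : ℝ} (hC : 0 ≤ C)
    {X Y : Module.End ℂ (finiteVectors m)}
    (hX : IsParticleBounded C X) (hY : IsParticleBounded C Y) (ψ : finiteVectors m) :
    Summable fun p : ℕ × ℕ => ‖((p.1.factorial : ℂ)⁻¹ * (p.2.factorial : ℂ)⁻¹) •
      ((X ^ p.1 * Y ^ p.2) ψ : FockSpace m)‖ := by
  obtain ⟨N, hN⟩ := exists_mem_particlesLE ψ
  have h1 := summable_pow_div_sqrt_factorial (2 * C)
  have h2 := ((h1.mul_of_nonneg h1 (fun _ => by positivity) fun _ => by positivity).mul_left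
    (√(2 ^ N) * ‖ψ‖))
  refine .of_nonneg_of_le (fun _ => norm_nonneg _) (fun p => ?_) h2
  obtain ⟨n, k⟩ := p
  have hk := hY.pow hC hN k
  have hn := hX.pow hC hk.1 n
  have h3 : ‖(X ^ n * Y ^ k) ψ‖ ≤
      C ^ n * C ^ k * √((N + 1).ascFactorial (k + n) : ℕ) * ‖ψ‖ := by
    refine hn.2.trans ?_
    calc _ ≤ C ^ n * √((N + k + 1).ascFactorial n) *
          (C ^ k * √((N + 1).ascFactorial k) * ‖ψ‖) := by
          gcongr
          exact hk.2
      _ = _ := by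
          rw [← Nat.ascFactorial_mul_ascFactorial, Nat.cast_mul, Real.sqrt_mul (by positivity),
            add_right_comm]
          ring
  have h4 : √((N + 1).ascFactorial (k + n) : ℕ) ≤
      √(2 ^ N) * (2 ^ n * √n.factorial) * (2 ^ k * √k.factorial) := by
    refine Real.sqrt_le_iff.2 ⟨by positivity, ?_⟩
    have h5 : ((N + 1).ascFactorial (k + n) : ℝ) ≤
        2 ^ N * (4 ^ n * n.factorial) * (4 ^ k * k.factorial) := by
      exact_mod_cast ascFactorial_add_le N n k
    refine h5.trans (le_of_eq ?_)
    simp only [mul_pow]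
    rw [Real.sq_sqrt (by positivity), Real.sq_sqrt (by positivity), Real.sq_sqrt (by positivity),
      ← pow_mul, ← pow_mul, mul_comm n, mul_comm k, pow_mul, pow_mul]
    norm_num
  have hsq : ∀ l : ℕ, (l.factorial : ℝ) = √l.factorial * √l.factorial := fun l =>
    (Real.mul_self_sqrt (by positivity)).symm
  rw [norm_smul, norm_mul, norm_inv, norm_inv, Complex.norm_natCast, Complex.norm_natCast]
  calc _ ≤ (n.factorial : ℝ)⁻¹ * (k.factorial : ℝ)⁻¹ * (C ^ n * C ^ k *
        (√(2 ^ N) * (2 ^ n * √n.factorial) * (2 ^ k * √k.factorial)) * ‖ψ‖) := by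
        refine mul_le_mul_of_nonneg_left (h3.trans ?_) (by positivity)
        gcongr
    _ = _ := by
        have hn0 : √(n.factorial : ℝ) ≠ 0 := by positivity
        have hk0 : √(k.factorial : ℝ) ≠ 0 := by positivity
        simp only [mul_pow]
        rw [hsq n, hsq k]
        simp only [Real.sqrt_mul_self (Real.sqrt_nonneg _)]
        field_simp

/-- Particle-bounded operators have entire vectors: `‖X ^ n ψ‖ ≤ K (2 C) ^ n √n!`. -/
theorem IsParticleBounded.hasEntireVectors {C : ℝ} (hC : 0 ≤ C)
    {X : Module.End ℂ (finiteVectors m)} (hX : IsParticleBounded C X) : HasEntireVectors X := by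
  intro ψ
  have h := (hX.summable_pow_mul_pow hC hX ψ).comp_injective
    (i := fun n => (n, 0)) fun a b h => congrArg Prod.fst h
  refine h.congr fun n => ?_
  simp

/-! ### Displacement operators -/

/-- The generator `α a_j† - α* a_j` of a displacement, on the finite-particle vectors. -/
noncomputable def generator (j : Fin m) (α : ℂ) : Module.End ℂ (finiteVectors m) :=
  α • create j - conj α • annihilate j

theorem isSkew_generator (j : Fin m) (α : ℂ) : IsSkew (generator j α) := by
  intro φ ψ
  simp only [generator, LinearMap.sub_apply, LinearMap.smul_apply, Submodule.coe_sub,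
    Submodule.coe_smul, inner_sub_left, inner_sub_right, inner_smul_left, inner_smul_right,
    inner_create, inner_annihilate, Complex.conj_conj]
  ring

theorem exists_isParticleBounded_generator (j : Fin m) (α : ℂ) :
    ∃ C, 0 ≤ C ∧ IsParticleBounded C (generator j α) := by
  refine ⟨‖α‖ * 1 + ‖-conj α‖ * 1, by positivity, ?_⟩
  rw [generator, sub_eq_add_neg,
    show -(conj α • annihilate j) = -conj α • annihilate j from (neg_smul _ _).symm]
  exact ((isParticleBounded_create j).smul α).add ((isParticleBounded_annihilate j).smul _)

theorem hasEntireVectors_generator (j : Fin m) (α : ℂ) : HasEntireVectors (generator j α) := by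
  obtain ⟨C, hC, h⟩ := exists_isParticleBounded_generator j α
  exact h.hasEntireVectors hC

theorem commute_generator {i j : Fin m} (hij : i ≠ j) (α β : ℂ) :
    Commute (generator i α) (generator j β) := by
  refine Commute.sub_left (Commute.sub_right ?_ ?_) (Commute.sub_right ?_ ?_)
  · exact ((commute_create hij).smul_left _).smul_right _
  · exact ((commute_create_annihilate hij).smul_left _).smul_right _
  · exact ((commute_create_annihilate hij.symm).symm.smul_left _).smul_right _
  · exact ((commute_annihilate hij).smul_left _).smul_right _

theorem mem_displacementGenerator_domain (j : Fin m) (α : ℂ) (ψ : finiteVectors m) :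
    (ψ : FockSpace m) ∈ (displacementGenerator j α).domain :=
  ⟨finiteVectors_le_creation_domain j ψ.2, finiteVectors_le_annihilation_domain j ψ.2⟩

theorem displacementGenerator_coe (j : Fin m) (α : ℂ) (ψ : finiteVectors m)
    (h : (ψ : FockSpace m) ∈ (displacementGenerator j α).domain) :
    displacementGenerator j α ⟨ψ, h⟩ = generator j α ψ := rfl

theorem isExp_displacementGenerator_iff {j : Fin m} {α : ℂ} {T : FockSpace m →L[ℂ] FockSpace m} :
    IsExp (displacementGenerator j α) T ↔ IsExpOn (generator j α) T := by
  constructor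
  · intro h ψ
    obtain ⟨φ, h0, hsucc, hsum⟩ := h ψ ψ.2
    have hφ : ∀ n, φ n = ((generator j α ^ n) ψ : FockSpace m) := by
      intro n
      induction n with
      | zero => exact h0
      | succ n ih =>
        obtain ⟨hn, hA⟩ := hsucc n
        rw [← hA, pow_succ', Module.End.mul_apply, ← displacementGenerator_coe j α _
          (mem_displacementGenerator_domain j α _)]
        congr 1
        exact Subtype.ext ih
    exact hsum.congr_fun fun n => by rw [hφ]
  · intro h ψ hψ
    refine ⟨fun n => (generator j α ^ n) ⟨ψ, hψ⟩, rfl, fun n => ?_, h ⟨ψ, hψ⟩⟩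
    refine ⟨mem_displacementGenerator_domain j α _, ?_⟩
    rw [displacementGenerator_coe, ← Module.End.mul_apply, ← pow_succ']

theorem existsUnique_isExp (j : Fin m) (α : ℂ) : ∃! T, IsExp (displacementGenerator j α) T := by
  obtain ⟨T, -, hT⟩ := exists_unitary_isExpOn dense_finiteVectors (isSkew_generator j α)
    (hasEntireVectors_generator j α)
  refine ⟨T, isExp_displacementGenerator_iff.2 hT, fun S hS => ?_⟩
  exact (isExp_displacementGenerator_iff.1 hS).unique dense_finiteVectors hT

theorem isExp_displacement (j : Fin m) (α : ℂ) :
    IsExp (displacementGenerator j α) (displacement j α) := by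
  have h := (existsUnique_isExp j α).exists
  rw [displacement, opExp, dif_pos h]
  exact h.choose_spec

theorem isExpOn_displacement (j : Fin m) (α : ℂ) :
    IsExpOn (generator j α) (displacement j α) :=
  isExp_displacementGenerator_iff.1 (isExp_displacement j α)

theorem displacement_mem_unitary (j : Fin m) (α : ℂ) :
    displacement j α ∈ unitary (FockSpace m →L[ℂ] FockSpace m) := by
  obtain ⟨T, hu, hT⟩ := exists_unitary_isExpOn dense_finiteVectors (isSkew_generator j α)
    (hasEntireVectors_generator j α)
  rwa [(isExpOn_displacement j α).unique dense_finiteVectors hT]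

theorem displacementProd_mem_unitary (lam : Fin m → ℂ) :
    displacementProd lam ∈ unitary (FockSpace m →L[ℂ] FockSpace m) := by
  refine Submonoid.list_prod_mem _ fun T hT => ?_
  obtain ⟨j, rfl⟩ := List.mem_ofFn.1 hT
  exact displacement_mem_unitary j _

theorem exists_isParticleBounded_sum_generator (lam : Fin m → ℂ) (s : List (Fin m)) :
    ∃ C, 0 ≤ C ∧ IsParticleBounded C (s.map fun j => generator j (lam j)).sum := by
  induction s with
  | nil => exact ⟨0, le_rfl, fun N ψ _ => ⟨zero_mem _, by simp⟩⟩
  | cons j s ih =>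
    obtain ⟨C, hC, h⟩ := ih
    obtain ⟨D, hD, h'⟩ := exists_isParticleBounded_generator j (lam j)
    exact ⟨D + C, by positivity, h'.add h⟩

theorem hasEntireVectors_sum_generator (lam : Fin m → ℂ) :
    HasEntireVectors (∑ j, generator j (lam j)) := by
  obtain ⟨C, hC, h⟩ := exists_isParticleBounded_sum_generator lam (List.finRange m)
  rw [Fin.sum_univ_def]
  exact h.hasEntireVectors hC

/-- The product of the displacement operators of the different modes is the exponential of the sum
of their generators, because these commute. -/
theorem isExpOn_displacementProd (lam : Fin m → ℂ) :
    IsExpOn (∑ j, generator j (lam j)) (displacementProd lam) := by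
  rw [Fin.sum_univ_def, displacementProd, List.ofFn_eq_map]
  generalize List.finRange m = s
  induction s with
  | nil =>
    intro ψ
    have h := hasSum_single (f := fun n : ℕ =>
      (n.factorial : ℂ)⁻¹ • (((0 : Module.End ℂ (finiteVectors m)) ^ n) ψ : FockSpace m)) 0
      fun n hn => by simp [zero_pow hn]
    simpa using h
  | cons j s ih =>
    rw [List.map_cons, List.map_cons, List.sum_cons, List.prod_cons]
    obtain ⟨C, hC, h⟩ := exists_isParticleBounded_sum_generator lam s
    obtain ⟨D, hD, h'⟩ := exists_isParticleBounded_generator j (lam j)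
    refine (isExpOn_displacement j (lam j)).mul ih ?_
      ((h'.mono (le_max_left D C)).summable_pow_mul_pow (hD.trans (le_max_left D C))
        (h.mono (le_max_right D C)))
    refine Commute.list_sum_right _ _ fun X hX => ?_
    obtain ⟨i, -, rfl⟩ := List.mem_map.1 hX
    rcases eq_or_ne j i with rfl | hij
    · exact Commute.refl _
    · exact commute_generator hij _ _

/-! ### Evolution of displacement operators -/

section Evolution

variable {V : Matrix (Fin m) (Fin m) ℂ} {W : unitary (FockSpace m →L[ℂ] FockSpace m)}

theorem unitary_apply_star_apply (W : unitary (FockSpace m →L[ℂ] FockSpace m)) (x : FockSpace m) :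
    W.1 ((star W).1 x) = x :=
  congrArg (fun C : FockSpace m →L[ℂ] FockSpace m => C x) (Unitary.mul_star_self_of_mem W.2)

theorem unitary_star_apply_apply (W : unitary (FockSpace m →L[ℂ] FockSpace m)) (x : FockSpace m) :
    (star W).1 (W.1 x) = x :=
  congrArg (fun C : FockSpace m →L[ℂ] FockSpace m => C x) (Unitary.star_mul_self_of_mem W.2)

theorem inner_unitary_right (W : unitary (FockSpace m →L[ℂ] FockSpace m)) (x y : FockSpace m) :
    inner ℂ x (W.1 y) = inner ℂ ((star W).1 x) y :=
  (ContinuousLinearMap.adjoint_inner_left W.1 y x).symm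

theorem EvolvesCreation.exists_creation (hW : EvolvesCreation V W) (j : Fin m)
    (ψ : finiteVectors m) :
    ∃ h : (star W).1 ψ ∈ (creation j).domain, creation j ⟨(star W).1 ψ, h⟩ =
      (star W).1 ((∑ k, V j k • create k ψ : finiteVectors m) : FockSpace m) := by
  obtain ⟨h, hc⟩ := hW j ψ ψ.2
  refine ⟨h, ?_⟩
  rw [← unitary_star_apply_apply W (creation j ⟨_, h⟩), hc]
  simp [coe_create]

/-- A unitary that evolves the creation operators by `V` evolves the annihilation operators by the
complex conjugate of `V`. -/
theorem EvolvesCreation.exists_annihilation (hW : EvolvesCreation V W) (j : Fin m)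
    (ψ : finiteVectors m) :
    ∃ h : (star W).1 ψ ∈ (annihilation j).domain, annihilation j ⟨(star W).1 ψ, h⟩ =
      (star W).1 ((∑ k, conj (V j k) • annihilate k ψ : finiteVectors m) : FockSpace m) := by
  have hd := creation_domain_le j (hW.exists_creation j ψ).1
  refine ⟨hd, ?_⟩
  rw [← unitary_star_apply_apply W (annihilation j ⟨_, hd⟩)]
  congr 1
  -- pairing with `χ ∈ F₀` turns `a_j W† ψ` into `a_j†` acting on `W† χ`
  refine dense_finiteVectors.eq_of_inner_right ℂ fun χ hχ => ?_
  obtain ⟨h, hc⟩ := hW.exists_creation j ⟨χ, hχ⟩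
  rw [inner_unitary_right]
  refine (inner_creation j ⟨_, h⟩ ⟨_, hd⟩).symm.trans ?_
  rw [hc, ← inner_unitary_right, unitary_apply_star_apply]
  simp only [Submodule.coe_sum, Submodule.coe_smul, sum_inner, inner_sum, inner_smul_left,
    inner_smul_right, inner_create]

theorem EvolvesCreation.inner_create_star (hW : EvolvesCreation V W) (j : Fin m)
    (φ ψ : finiteVectors m) :
    inner ℂ (create j φ : FockSpace m) ((star W).1 ψ) = inner ℂ (φ : FockSpace m)
      ((star W).1 ((∑ k, conj (V j k) • annihilate k ψ : finiteVectors m) : FockSpace m)) := by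
  obtain ⟨h, hc⟩ := hW.exists_annihilation j ψ
  rw [← hc]
  exact inner_creation j ⟨φ, finiteVectors_le_creation_domain j φ.2⟩ ⟨_, h⟩

theorem EvolvesCreation.inner_annihilate_star (hW : EvolvesCreation V W) (j : Fin m)
    (φ ψ : finiteVectors m) :
    inner ℂ (annihilate j φ : FockSpace m) ((star W).1 ψ) = inner ℂ (φ : FockSpace m)
      ((star W).1 ((∑ k, V j k • create k ψ : finiteVectors m) : FockSpace m)) := by
  obtain ⟨h, hc⟩ := hW.exists_creation j ψ
  rw [← hc, ← inner_conj_symm]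
  refine (congrArg conj (inner_creation j ⟨_, h⟩
    ⟨φ, finiteVectors_le_annihilation_domain j φ.2⟩).symm).trans ?_
  exact inner_conj_symm _ _

/-- The weak form of `W (∑ j, λ_j a_j† - λ_j* a_j) W† = ∑ k, μ_k a_k† - μ_k* a_k` with
`μ_k = ∑ j, V_{j,k} λ_j`. -/
theorem EvolvesCreation.inner_sum_generator_star (hW : EvolvesCreation V W) (lam : Fin m → ℂ)
    (φ ψ : finiteVectors m) :
    inner ℂ (((∑ j, generator j (lam j)) φ : finiteVectors m) : FockSpace m) ((star W).1 ψ) =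
      -inner ℂ (φ : FockSpace m) ((star W).1
        (((∑ k, generator k (∑ j, V j k * lam j)) ψ : finiteVectors m) : FockSpace m)) := by
  simp only [LinearMap.sum_apply, generator, LinearMap.sub_apply, LinearMap.smul_apply,
    Submodule.coe_sum, Submodule.coe_sub, Submodule.coe_smul, sum_inner, inner_sub_left,
    inner_smul_left, hW.inner_create_star, hW.inner_annihilate_star, map_sum, map_sub, map_smul,
    inner_sum, inner_sub_right, inner_smul_right, Complex.conj_conj, map_mul]
  simp only [Finset.sum_mul, Finset.mul_sum, ← Finset.sum_sub_distrib, ← Finset.sum_neg_distrib]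
  rw [Finset.sum_comm]
  refine Finset.sum_congr rfl fun k _ => Finset.sum_congr rfl fun j _ => ?_
  ring

/-- The displacement operators evolve linearly: the exponential series of the transformed generator
at `ψ ∈ F₀` is carried by `W†` to a weak exponential series at `W† ψ`. -/
theorem EvolvesCreation.mul_displacementProd_mul_star (hW : EvolvesCreation V W)
    (lam : Fin m → ℂ) :
    W.1 * displacementProd lam * (star W).1 = displacementProd fun k => ∑ j, V j k * lam j := by
  refine ContinuousLinearMap.eq_of_eqOn_dense_submodule dense_finiteVectors fun ψ => ?_
  set mu : Fin m → ℂ := fun k => ∑ j, V j k * lam j with hmu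
  set Y : Module.End ℂ (finiteVectors m) := ∑ k, generator k (mu k) with hY
  have hnorm : ∀ x, ‖(star W).1 x‖ = ‖x‖ := fun x => by
    have h : ((star W).1 : FockSpace m →L[ℂ] FockSpace m) ∈ unitary _ := (star W).2
    exact (ContinuousLinearMap.norm_map_iff_adjoint_comp_self _).2 h.1 x
  have h1 := (isExpOn_displacementProd lam).hasSum_of_weak dense_finiteVectors
    (displacementProd_mem_unitary lam) (hasEntireVectors_sum_generator lam)
    (v := fun n => (star W).1 ((Y ^ n) ψ : FockSpace m))
    ((hasEntireVectors_sum_generator mu ψ).congr fun n => by rw [norm_smul, norm_smul, hnorm])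
    fun φ n => by
      rw [hW.inner_sum_generator_star, pow_succ', Module.End.mul_apply]
  have h2 : HasSum (fun n => (n.factorial : ℂ)⁻¹ • (star W).1 ((Y ^ n) ψ : FockSpace m))
      ((star W).1 (displacementProd mu ψ)) := by
    simpa using (isExpOn_displacementProd mu ψ).mapL (star W).1
  have h3 : displacementProd lam ((star W).1 ψ) = (star W).1 (displacementProd mu ψ) :=
    h1.unique h2
  calc W.1 (displacementProd lam ((star W).1 ψ)) = W.1 ((star W).1 (displacementProd mu ψ)) := by
        rw [h3]
    _ = _ := unitary_apply_star_apply W _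

end Evolution

/-! ### The polynomial model -/

open MvPolynomial

/-- The product `n₁! ⋯ n_m!`. -/
def multiFactorial (n : Fin m → ℕ) : ℕ := ∏ i, (n i).factorial

theorem multiFactorial_ne_zero (n : Fin m → ℕ) : multiFactorial n ≠ 0 :=
  Finset.prod_ne_zero_iff.2 fun i _ => (n i).factorial_ne_zero

theorem sqrt_multiFactorial_ne_zero (n : Fin m → ℕ) : (√(multiFactorial n : ℝ) : ℂ) ≠ 0 := by
  have := Nat.pos_of_ne_zero (multiFactorial_ne_zero n)
  exact Complex.ofReal_ne_zero.2 (by positivity)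

theorem multiFactorial_add_single (n : Fin m → ℕ) (j : Fin m) :
    multiFactorial (n + Pi.single j 1) = (n j + 1) * multiFactorial n := by
  have h : ∀ i, ((n + Pi.single j 1 : Fin m → ℕ) i).factorial =
      (if i = j then n j + 1 else 1) * (n i).factorial := by
    intro i
    rcases eq_or_ne i j with rfl | hi
    · simp [Nat.factorial_succ]
    · simp [hi]
  rw [multiFactorial, Finset.prod_congr rfl fun i _ => h i, Finset.prod_mul_distrib]
  simp [multiFactorial]

/-- The exponent vector with coordinates `n`, as a finitely supported function. -/
noncomputable abbrev exponent (n : Fin m → ℕ) : Fin m →₀ ℕ := Finsupp.equivFunOnFinite.symm n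

theorem exponent_zero : exponent (0 : Fin m → ℕ) = 0 := by
  ext
  simp

/-- The vector `p(a_1†, …, a_m†) |0⟩` of a polynomial `p`: the monomial `X^n` is mapped to
`√(n!) |n⟩`. -/
noncomputable def ofPoly : MvPolynomial (Fin m) ℂ →ₗ[ℂ] finiteVectors m where
  toFun p :=
    have hfin : (Function.support fun n : Fin m → ℕ =>
        (√(multiFactorial n : ℝ) : ℂ) * p.coeff (exponent n)).Finite := by
      refine (p.support.finite_toSet.image Finsupp.equivFunOnFinite).subset fun n hn => ?_
      exact ⟨exponent n, mem_support_iff.2 (right_ne_zero_of_mul hn), by simp⟩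
    ⟨⟨_, (memℓp_zero (E := fun _ : Fin m → ℕ => ℂ) hfin).of_exponent_ge (by simp)⟩, hfin⟩
  map_add' p q := finiteVectors_ext fun n => by
    change _ * coeff _ (p + q) = _ * coeff _ p + _ * coeff _ q
    rw [coeff_add, mul_add]
  map_smul' c p := finiteVectors_ext fun n => by
    change _ * coeff _ (c • p) = c * (_ * coeff _ p)
    rw [coeff_smul, smul_eq_mul]
    ring

theorem ofPoly_apply (p : MvPolynomial (Fin m) ℂ) (n : Fin m → ℕ) :
    (ofPoly p).1 n = (√(multiFactorial n : ℝ) : ℂ) * p.coeff (exponent n) := rfl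

theorem ofPoly_injective : Function.Injective (ofPoly (m := m)) := by
  intro p q h
  ext s
  have h1 := congrArg (fun ψ : finiteVectors m => ψ.1 s) h
  simp only [ofPoly_apply] at h1
  simpa using mul_left_cancel₀ (sqrt_multiFactorial_ne_zero _) h1

theorem ofPoly_surjective : Function.Surjective (ofPoly (m := m)) := by
  intro ψ
  have hfin : (Function.support fun n => ψ.1 n).Finite := ψ.2
  refine ⟨∑ n ∈ hfin.toFinset, monomial (exponent n) ((√(multiFactorial n : ℝ) : ℂ)⁻¹ * ψ.1 n),
    finiteVectors_ext fun n => ?_⟩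
  simp only [ofPoly_apply, coeff_sum, coeff_monomial, EmbeddingLike.apply_eq_iff_eq]
  rw [Finset.sum_ite_eq']
  have h0 := sqrt_multiFactorial_ne_zero n
  by_cases h : ψ.1 n = 0
  · simp [h]
  · rw [if_pos (by simpa using h), mul_inv_cancel_left₀ h0]

theorem ofPoly_X_mul (j : Fin m) (p : MvPolynomial (Fin m) ℂ) :
    ofPoly (X j * p) = create j (ofPoly p) := by
  refine finiteVectors_ext fun n => ?_
  rw [create_apply, ofPoly_apply, ofPoly_apply, coeff_X_mul']
  by_cases h : n j = 0
  · simp [h]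
  · have h1 := multiFactorial_add_single (n - Pi.single j 1) j
    rw [sub_single_add_single h, Pi.sub_apply, Pi.single_eq_same,
      Nat.sub_add_cancel (Nat.pos_of_ne_zero h)] at h1
    have h2 : exponent n - Finsupp.single j 1 = exponent (n - Pi.single j 1) := by
      ext i
      simp [Finsupp.single_apply, Pi.single_apply, eq_comm]
    rw [if_pos (by simpa using h), h2, h1, Nat.cast_mul, Real.sqrt_mul (by positivity)]
    push_cast
    ring

theorem ofPoly_pderiv (j : Fin m) (p : MvPolynomial (Fin m) ℂ) :
    ofPoly (pderiv j p) = annihilate j (ofPoly p) := by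
  refine finiteVectors_ext fun n => ?_
  have h2 : exponent n + Finsupp.single j 1 = exponent (n + Pi.single j 1) := by
    ext i
    simp [Finsupp.single_apply, Pi.single_apply, eq_comm]
  rw [annihilate_apply, ofPoly_apply, ofPoly_apply, coeff_pderiv, h2, multiFactorial_add_single,
    Nat.cast_mul, Real.sqrt_mul (by positivity)]
  have h3 : (√((n j : ℝ) + 1) : ℂ) * √((n j : ℝ) + 1) = n j + 1 := by
    rw [← Complex.ofReal_mul, Real.mul_self_sqrt (by positivity)]
    simp
  push_cast
  simp
  linear_combination (-(√(multiFactorial n : ℝ) : ℂ) * coeff (exponent (n + Pi.single j 1)) p) * h3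

theorem ofPoly_one : (ofPoly (1 : MvPolynomial (Fin m) ℂ) : FockSpace m) = vacuum m := by
  refine lp.ext (funext fun n => ?_)
  rw [ofPoly_apply, vacuum, coeff_one]
  rcases eq_or_ne n 0 with rfl | hn
  · simp [multiFactorial, exponent_zero]
  · rw [lp.single_apply_ne _ _ _ hn, if_neg, mul_zero]
    intro h
    refine hn (funext fun i => ?_)
    simpa using (DFunLike.congr_fun h i).symm

theorem inner_vacuum (ψ : FockSpace m) : inner ℂ (vacuum m) ψ = ψ 0 := by
  rw [vacuum, lp.inner_single_left]
  simp

/-- The linear substitution `X_j ↦ ∑ k, V_{j,k} X_k`. -/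
noncomputable def linearSubst (V : Matrix (Fin m) (Fin m) ℂ) :
    MvPolynomial (Fin m) ℂ →ₐ[ℂ] MvPolynomial (Fin m) ℂ :=
  aeval fun j => ∑ k, V j k • X k

theorem linearSubst_X (V : Matrix (Fin m) (Fin m) ℂ) (j : Fin m) :
    linearSubst V (X j) = ∑ k, V j k • X k := aeval_X _ _

theorem linearSubst_linearSubst {V V' : Matrix (Fin m) (Fin m) ℂ} (h : V' * V = 1)
    (p : MvPolynomial (Fin m) ℂ) : linearSubst V (linearSubst V' p) = p := by
  have : (linearSubst V).comp (linearSubst V') = AlgHom.id ℂ _ := by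
    refine algHom_ext fun j => ?_
    simp only [AlgHom.comp_apply, linearSubst_X, map_sum, map_smul, Finset.smul_sum, smul_smul,
      AlgHom.id_apply]
    rw [Finset.sum_comm]
    simp only [← Finset.sum_smul, ← Matrix.mul_apply, h]
    simp [Matrix.one_apply]
  exact DFunLike.congr_fun this p

theorem constantCoeff_linearSubst (V : Matrix (Fin m) (Fin m) ℂ) (p : MvPolynomial (Fin m) ℂ) :
    constantCoeff (linearSubst V p) = constantCoeff p := by
  induction p using MvPolynomial.induction_on with
  | C a => simp [linearSubst]
  | add p q hp hq => simp [hp, hq]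
  | mul_X p j _ =>
    rw [map_mul, map_mul, map_mul, linearSubst_X, map_sum]
    simp [smul_eq_C_mul]

/-- The chain rule for a linear substitution. -/
theorem pderiv_linearSubst (V : Matrix (Fin m) (Fin m) ℂ) (j : Fin m)
    (p : MvPolynomial (Fin m) ℂ) :
    pderiv j (linearSubst V p) = ∑ k, V k j • linearSubst V (pderiv k p) := by
  induction p using MvPolynomial.induction_on with
  | C a => simp [linearSubst]
  | add p q hp hq => simp [hp, hq, Finset.sum_add_distrib]
  | mul_X p i hp =>
    have h1 : pderiv j (linearSubst V (X i)) = C (V i j) := by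
      simp [linearSubst_X, pderiv_X, Pi.single_apply, smul_eq_C_mul]
    have h2 : ∀ k, linearSubst V (pderiv k (X i)) = if k = i then 1 else 0 := by
      intro k
      rcases eq_or_ne k i with rfl | hk
      · rw [pderiv_X_self, map_one, if_pos rfl]
      · rw [pderiv_X_of_ne hk.symm, map_zero, if_neg hk]
    simp only [map_mul, pderiv_mul, hp, h1, map_add, h2, smul_add, Finset.sum_add_distrib,
      Finset.sum_mul, smul_mul_assoc]
    simp [smul_eq_C_mul, mul_comm (linearSubst V p)]

/-- The substitutions of a matrix and of its conjugate transpose are adjoint to each other: a factor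
`X_j` is moved across the inner product as the derivative `∂_j`, and the chain rule applies. -/
theorem inner_ofPoly_linearSubst (V : Matrix (Fin m) (Fin m) ℂ) (p q : MvPolynomial (Fin m) ℂ) :
    inner ℂ (ofPoly (linearSubst V p) : FockSpace m) (ofPoly q : FockSpace m) =
      inner ℂ (ofPoly p : FockSpace m) (ofPoly (linearSubst (star V) q) : FockSpace m) := by
  induction p using MvPolynomial.induction_on generalizing q with
  | C a =>
    have h : ∀ r : MvPolynomial (Fin m) ℂ,
        inner ℂ (ofPoly (C a : MvPolynomial (Fin m) ℂ) : FockSpace m) (ofPoly r : FockSpace m) =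
          conj a * constantCoeff r := by
      intro r
      rw [C_eq_smul_one, map_smul, Submodule.coe_smul, inner_smul_left, ofPoly_one, inner_vacuum,
        ofPoly_apply, constantCoeff_eq]
      simp [multiFactorial, exponent_zero]
    have h1 : linearSubst V (C a) = C a := by simp [linearSubst]
    rw [h1, h, h, constantCoeff_linearSubst]
  | add p q hp hq => simp [hp, hq]
  | mul_X p j hp =>
    have h : ∀ (k : Fin m) (r s : MvPolynomial (Fin m) ℂ),
        inner ℂ (ofPoly (r * X k) : FockSpace m) (ofPoly s : FockSpace m) =
          inner ℂ (ofPoly r : FockSpace m) (ofPoly (pderiv k s) : FockSpace m) := by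
      intro k r s
      rw [mul_comm, ofPoly_X_mul, inner_create, ofPoly_pderiv]
    rw [h, pderiv_linearSubst, map_mul, linearSubst_X, Finset.mul_sum]
    simp only [map_sum, mul_smul_comm, map_smul, Submodule.coe_sum, Submodule.coe_smul, sum_inner,
      inner_sum, inner_smul_left, inner_smul_right, h, hp]
    rfl

/-! ### The linear-optical unitary -/

/-- The finite-particle vectors as polynomials in the creation operators. -/
noncomputable def polyEquiv : MvPolynomial (Fin m) ℂ ≃ₗ[ℂ] finiteVectors m :=
  LinearEquiv.ofBijective ofPoly ⟨ofPoly_injective, ofPoly_surjective⟩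

/-- A vacuum-preserving unitary that evolves the creation operators by `V` acts on polynomials in
the creation operators as the substitution of `V`. -/
theorem EvolvesCreation.apply_ofPoly {V : Matrix (Fin m) (Fin m) ℂ}
    {W : unitary (FockSpace m →L[ℂ] FockSpace m)} (hW : EvolvesCreation V W)
    (h0 : W.1 (vacuum m) = vacuum m) (p : MvPolynomial (Fin m) ℂ) :
    W.1 (ofPoly p) = ofPoly (linearSubst V p) := by
  induction p using MvPolynomial.induction_on with
  | C a =>
    have h1 : linearSubst V (C a) = C a := by simp [linearSubst]
    rw [h1, C_eq_smul_one, map_smul, Submodule.coe_smul, ofPoly_one, map_smul, h0]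
  | add p q hp hq => simp [hp, hq]
  | mul_X p j hp =>
    have hs : (star W).1 (ofPoly (linearSubst V p) : FockSpace m) = ofPoly p := by
      rw [← hp, unitary_star_apply_apply]
    obtain ⟨h, hc⟩ := hW.exists_creation j (ofPoly (linearSubst V p))
    have h1 : (ofPoly (p * X j) : FockSpace m) = creation j ⟨_, h⟩ := by
      rw [mul_comm, ofPoly_X_mul, coe_create]
      congr 1
      exact Subtype.ext hs.symm
    rw [h1, hc, unitary_apply_star_apply, map_mul, linearSubst_X, Finset.mul_sum, map_sum]
    congr 1
    refine Finset.sum_congr rfl fun k _ => ?_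
    rw [mul_smul_comm, map_smul, mul_comm, ofPoly_X_mul]

theorem existsUnique_evolvesCreation {V : Matrix (Fin m) (Fin m) ℂ}
    (hV : V ∈ Matrix.unitaryGroup (Fin m) ℂ) :
    ∃! W : unitary (FockSpace m →L[ℂ] FockSpace m),
      EvolvesCreation V W ∧ W.1 (vacuum m) = vacuum m := by
  let T : Matrix (Fin m) (Fin m) ℂ → (finiteVectors m →ₗ[ℂ] FockSpace m) := fun A =>
    (finiteVectors m).subtype ∘ₗ ofPoly ∘ₗ (linearSubst A).toLinearMap ∘ₗ
      polyEquiv.symm.toLinearMap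
  have hT : ∀ A p, T A (ofPoly p) = ofPoly (linearSubst A p) := by
    intro A p
    have : polyEquiv.symm (ofPoly p) = p := polyEquiv.symm_apply_apply p
    simp [T, this]
  have hadj : ∀ A, ∀ φ ψ : finiteVectors m,
      inner ℂ (T A φ) (ψ : FockSpace m) = inner ℂ (φ : FockSpace m) (T (star A) ψ) := by
    intro A φ ψ
    obtain ⟨p, rfl⟩ := ofPoly_surjective φ
    obtain ⟨q, rfl⟩ := ofPoly_surjective ψ
    rw [hT, hT, inner_ofPoly_linearSubst]
  have hnorm : ∀ A : Matrix (Fin m) (Fin m) ℂ, A * star A = 1 → ∀ φ, ‖T A φ‖ = ‖φ‖ := by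
    intro A hA φ
    obtain ⟨p, rfl⟩ := ofPoly_surjective φ
    have h : inner ℂ (T A (ofPoly p)) (T A (ofPoly p)) =
        inner ℂ (ofPoly p : FockSpace m) (ofPoly p : FockSpace m) := by
      rw [hT, inner_ofPoly_linearSubst, linearSubst_linearSubst hA]
    rw [inner_self_eq_norm_sq_to_K, inner_self_eq_norm_sq_to_K] at h
    have h' : ‖T A (ofPoly p)‖ ^ 2 = ‖ofPoly p‖ ^ 2 := by exact_mod_cast h
    exact (pow_left_inj₀ (norm_nonneg _) (norm_nonneg _) two_ne_zero).1 h'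
  obtain ⟨W, hW, hWs⟩ := exists_unitary_extension dense_finiteVectors (T V) (T (star V))
    (hnorm V hV.2) (hnorm (star V) (by rw [star_star]; exact hV.1)) (hadj V)
  refine ⟨W, ⟨?_, ?_⟩, ?_⟩
  · intro j ψ hψ
    obtain ⟨p, hp⟩ := ofPoly_surjective ⟨ψ, hψ⟩
    have hp' : ψ = ofPoly p := by rw [hp]
    subst hp'
    have hs : (star W).1 (ofPoly p : FockSpace m) = ofPoly (linearSubst (star V) p) := by
      rw [hWs, hT]
    refine ⟨hs ▸ finiteVectors_le_creation_domain j (ofPoly (linearSubst (star V) p)).2, ?_⟩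
    have h1 : ∀ h, creation j ⟨(star W).1 (ofPoly p : FockSpace m), h⟩ =
        ofPoly (X j * linearSubst (star V) p) := by
      intro h
      rw [ofPoly_X_mul, coe_create]
      congr 1
      exact Subtype.ext hs
    rw [h1, hW, hT, map_mul, linearSubst_linearSubst hV.1, linearSubst_X, Finset.sum_mul, map_sum,
      Submodule.coe_sum]
    refine Finset.sum_congr rfl fun k _ => ?_
    rw [smul_mul_assoc, map_smul, Submodule.coe_smul, ofPoly_X_mul, coe_create]
  · rw [← ofPoly_one, hW, hT, map_one]
  · rintro W' ⟨hW', h0⟩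
    refine Subtype.ext (ContinuousLinearMap.eq_of_eqOn_dense_submodule dense_finiteVectors
      fun ψ => ?_)
    obtain ⟨p, rfl⟩ := ofPoly_surjective ψ
    rw [hW'.apply_ofPoly h0, hW, hT]

end FockSpace

theorem mainTheorem2 (m : ℕ) (U : Matrix (Fin m) (Fin m) ℂ)
    (hU : U ∈ Matrix.unitaryGroup (Fin m) ℂ) :
    -- the displacement operators are well defined, as exponentials, and unitary
    (∀ (j : Fin m) (α : ℂ),
      (∃! T, FockSpace.IsExp (FockSpace.displacementGenerator j α) T) ∧
      FockSpace.IsExp (FockSpace.displacementGenerator j α) (FockSpace.displacement j α) ∧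
      FockSpace.displacement j α ∈ unitary (FockSpace m →L[ℂ] FockSpace m)) ∧
    -- the linear-optical unitary exists, in either index convention
    (∃! W : unitary (FockSpace m →L[ℂ] FockSpace m),
      FockSpace.EvolvesCreation U W ∧ W.1 (FockSpace.vacuum m) = FockSpace.vacuum m) ∧
    (∃! W : unitary (FockSpace m →L[ℂ] FockSpace m),
      FockSpace.EvolvesCreation U.transpose W ∧
        W.1 (FockSpace.vacuum m) = FockSpace.vacuum m) ∧
    -- convention `W a_j† W† = ∑ k, U_{k,j} a_k†`
    (∀ W : unitary (FockSpace m →L[ℂ] FockSpace m), FockSpace.EvolvesCreation U.transpose W →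
      ∀ lam : Fin m → ℂ,
        W.1 * FockSpace.displacementProd lam * (star W).1 =
          FockSpace.displacementProd fun j => ∑ k, U j k * lam k) ∧
    -- convention `W a_j† W† = ∑ k, U_{j,k} a_k†`
    (∀ W : unitary (FockSpace m →L[ℂ] FockSpace m), FockSpace.EvolvesCreation U W →
      ∀ lam : Fin m → ℂ,
        W.1 * FockSpace.displacementProd lam * (star W).1 =
          FockSpace.displacementProd fun j => ∑ k, U k j * lam k) := by
  have hU' : U.transpose ∈ Matrix.unitaryGroup (Fin m) ℂ :=
    Matrix.transpose_mem_unitaryGroup_iff.2 hU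
  refine ⟨fun j α => ⟨FockSpace.existsUnique_isExp j α, FockSpace.isExp_displacement j α,
    FockSpace.displacement_mem_unitary j α⟩, FockSpace.existsUnique_evolvesCreation hU,
    FockSpace.existsUnique_evolvesCreation hU',
    fun W hW lam => hW.mul_displacementProd_mul_star lam,
    fun W hW lam => hW.mul_displacementProd_mul_star lam⟩
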